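/- **Theorem.** All processes and filtrations are indexed by the nonpositive integers. The Pascal graph has the vertices $0,1,\dots,|n|$ at each level $n\le 0$, and the vertex $v$ of level $n$ is connected, by one edge each, to the vertices $v$ and $v+1$ of level $n-1$. Let $\Gamma_B$ be the Borel space of infinite paths $\gamma=(\gamma_n)_{n\le 0}$ starting at the root (the vertex of level $0$), where $\gamma_n$ is the edge between levels $n-1$ and $n$ and consecutive edges are connected; let $V_n$ be the vertex of the path at level $n$. Let $\mu$ be a probability measure on $\Gamma_B$ such that * $\mu$ is ergodic: the tail $\sigma$-field $\bigcap_{n\le 0}\sigma(\gamma_m;\,m\le n)$ contains only events of probability $0$ or $1$; * under $\mu$, $(V_n)_{n\le 0}$ is a (possibly inhomogeneous) Markov process: $\mathcal L(V_{n+1}\mid V_m,\,m\le n)=\mathcal L(V_{n+1}\mid V_n)$ almost surely for every $n<0$. Let $\mathcal F$ be the filtration $\mathcal F_n=\sigma(V_m;\,m\le n)$. Then, up to isomorphism, $\mathcal F$ admits a generating parameterization, and $\mathcal F$ is standard. Explicitly, with all inclusions of $\sigma$-fields understood up to null sets: 1. (*Generating parameterization.*) On some probability space there are a process $(V'_n)_{n\le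 0}$ with the same law as $(V_n)_{n\le 0}$ under $\mu$, generating the filtration $\mathcal F'_n=\sigma(V'_m;\,m\le n)$, and random variables $(U_n)_{n\le 0}$ such that for every $n\le 0$: $U_n$ is independent of $\mathcal F'_{n-1}\vee\sigma(U_m;\,m\le n-1)$; $\mathcal F'_n\subset\mathcal F'_{n-1}\vee\sigma(U_n)$; and $\mathcal F'_n\subset\sigma(U_m;\,m\le n)$. 2. (*Standardness.*) On some probability space there are a process $(V'_n)_{n\le 0}$ with the same law as $(V_n)_{n\le 0}$ under $\mu$, generating the filtration $\mathcal F'$, and a filtration $\mathcal G_n=\sigma(W_m;\,m\le n)$ generated by a sequence $(W_n)_{n\le 0}$ of independent random variables, such that $\mathcal F'$ is immersed in $\mathcal G$: $\mathcal F'_n\subset\mathcal G_n$ for every $n\le 0$, and for every $n<0$ the $\sigma$-field $\mathcal F'_{n+1}$ is conditionally independent of $\mathcal G_n$ given $\mathcal F'_n$. -/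

import Mathlib

open MeasureTheory ProbabilityTheory

/-! Time runs through the nonpositive integers `n ≤ 0`.  Everything is indexed by the depth
`k = |n| = -n : ℕ`, so that `k + 1` is the instant (or level) just *before* `k`, the final instant
is `k = 0`, and `n → -∞` reads `k → ∞`.  A filtration is then a sequence of σ-fields `F k` which
decreases as `k` grows. -/

namespace PascalWalk

section Filtrations

variable {Ω : Type*}

/-- The filtration generated by a process: at depth `k` it is `σ(X j ; j ≥ k)`, that is, the
σ-field generated by the process up to time `-k`. -/
abbrev generatedFiltration {E : ℕ → Type*} [∀ k, MeasurableSpace (E k)]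
    (X : ∀ k, Ω → E k) (k : ℕ) : MeasurableSpace Ω :=
  ⨆ j ≥ k, MeasurableSpace.comap (X j) inferInstance

/-- Inclusion of σ-fields up to null sets: every event of `m₁` is almost surely equal to an event
of `m₂`. -/
def SubsetAE [MeasurableSpace Ω] (P : Measure Ω) (m₁ m₂ : MeasurableSpace Ω) : Prop :=
  m₁ ≤ eventuallyMeasurableSpace m₂ (ae P)

/-- A filtration is Kolmogorovian when its tail σ-field is degenerate. -/
def IsKolmogorovian [MeasurableSpace Ω] (P : Measure Ω) (F : ℕ → MeasurableSpace Ω) : Prop :=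
  ∀ s : Set Ω, MeasurableSet[⨅ k, F k] s → P s = 0 ∨ P s = 1

/-- The (inhomogeneous) Markov property of a process with respect to its own filtration: given the
past, the conditional law of the next state only depends on the present state. -/
def IsMarkov [MeasurableSpace Ω] (P : Measure Ω) {E : ℕ → Type*} [∀ k, MeasurableSpace (E k)]
    (X : ∀ k, Ω → E k) : Prop :=
  ∀ k, ∀ A : Set (E k), MeasurableSet A →
    P⟦X k ⁻¹' A | generatedFiltration X (k + 1)⟧ =ᵐ[P]
      P⟦X k ⁻¹' A | MeasurableSpace.comap (X (k + 1)) inferInstance⟧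

/-- Conditional independence of the σ-fields `m₁` and `m₂` given the σ-field `m`. -/
def CondIndepGiven [MeasurableSpace Ω] (P : Measure Ω) (m m₁ m₂ : MeasurableSpace Ω) : Prop :=
  ∀ A B : Set Ω, MeasurableSet[m₁] A → MeasurableSet[m₂] B →
    P⟦A ∩ B | m⟧ =ᵐ[P] P⟦A | m⟧ * P⟦B | m⟧

/-- `F` is immersed in `G`: `F ⊂ G`, and at each instant the next σ-field of `F` is conditionally
independent of the present σ-field of `G` given the present σ-field of `F`. -/
def IsImmersed [MeasurableSpace Ω] (P : Measure Ω) (F G : ℕ → MeasurableSpace Ω) : Prop :=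
  (∀ k, SubsetAE P (F k) (G k)) ∧ ∀ k, CondIndepGiven P (F (k + 1)) (F k) (G (k + 1))

/-- A filtration is of product type when it is generated by a sequence of independent random
variables. -/
def IsProductType [MeasurableSpace Ω] (P : Measure Ω) (G : ℕ → MeasurableSpace Ω) : Prop :=
  ∃ U : ℕ → Ω → ℝ, (∀ k, Measurable (U k)) ∧ iIndepFun U P ∧ G = generatedFiltration U

/-- A parameterization of the filtration `F`: random variables `U k` such that `U k` is independent
of all that precedes (both for `F` and for `U`) and, added to the preceding σ-field of `F`, it
determines the present one. -/
structure IsParameterization [MeasurableSpace Ω] (P : Measure Ω) (F : ℕ → MeasurableSpace Ω)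
    (U : ℕ → Ω → ℝ) : Prop where
  measurable : ∀ k, Measurable (U k)
  indep : ∀ k, Indep (MeasurableSpace.comap (U k) inferInstance)
    (F (k + 1) ⊔ generatedFiltration U (k + 1)) P
  subset : ∀ k, SubsetAE P (F k) (F (k + 1) ⊔ MeasurableSpace.comap (U k) inferInstance)

/-- A parameterization is generating when `F` is contained in the filtration generated by `U`. -/
def IsGeneratingParameterization [MeasurableSpace Ω] (P : Measure Ω) (F : ℕ → MeasurableSpace Ω)
    (U : ℕ → Ω → ℝ) : Prop :=
  IsParameterization P F U ∧ ∀ k, SubsetAE P (F k) (generatedFiltration U k)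

variable {Ω' : Type*}

/-- `X'`, defined on `(Ω', P')`, is a copy of the process `X`, defined on `(Ω, P)`: the two
processes have the same law.  The filtration of a copy of `X` is, by definition, a filtration
isomorphic to that of `X`. -/
def IsCopy [MeasurableSpace Ω] [MeasurableSpace Ω'] {E : ℕ → Type*} [∀ k, MeasurableSpace (E k)]
    (P' : Measure Ω') (X' : ∀ k, Ω' → E k) (P : Measure Ω) (X : ∀ k, Ω → E k) : Prop :=
  (∀ k, Measurable (X' k)) ∧
    P'.map (fun ω k => X' k ω) = P.map (fun ω k => X k ω)

/-- Up to isomorphism, the filtration generated by `X` admits a generating parameterization. -/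
def AdmitsGeneratingParameterization [MeasurableSpace Ω] {E : ℕ → Type*}
    [∀ k, MeasurableSpace (E k)] (P : Measure Ω) (X : ∀ k, Ω → E k) : Prop :=
  ∃ (Ω' : Type) (_ : MeasurableSpace Ω') (P' : Measure Ω') (_ : IsProbabilityMeasure P')
    (X' : ∀ k, Ω' → E k) (U : ℕ → Ω' → ℝ),
    IsCopy P' X' P X ∧ IsGeneratingParameterization P' (generatedFiltration X') U

/-- The filtration generated by `X` is standard: up to isomorphism, it is immersed in a filtration
of product type. -/
def IsStandard [MeasurableSpace Ω] {E : ℕ → Type*} [∀ k, MeasurableSpace (E k)]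
    (P : Measure Ω) (X : ∀ k, Ω → E k) : Prop :=
  ∃ (Ω' : Type) (_ : MeasurableSpace Ω') (P' : Measure Ω') (_ : IsProbabilityMeasure P')
    (X' : ∀ k, Ω' → E k) (G : ℕ → MeasurableSpace Ω'),
    IsCopy P' X' P X ∧ IsProductType P' G ∧ IsImmersed P' (generatedFiltration X') G

end Filtrations

section PascalGraph

/-- The vertices of the Pascal graph at level `-k` are `0, …, k`. -/
abbrev Vertex (k : ℕ) : Type := Fin (k + 1)

/-- The edges of the Pascal graph between the levels `-k` and `-(k + 1)`: the vertex `v` of level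
`-k` is connected, by one edge each, to the vertices `v` and `v + 1` of level `-(k + 1)`. -/
abbrev Edge (k : ℕ) : Type :=
  {e : Vertex k × Vertex (k + 1) // (e.2 : ℕ) = e.1 ∨ (e.2 : ℕ) = e.1 + 1}

/-- The infinite paths of the Pascal graph: sequences of connected edges, one between any two
consecutive levels, starting at the root (the only vertex of level `0`).  The Borel structure is
the one inherited from the product of the finite discrete sets `Edge k`. -/
abbrev Path : Type :=
  {γ : ∀ k, Edge k // ∀ k, (γ k).1.2 = (γ (k + 1)).1.1}

/-- The edge of a path between the levels `-k` and `-(k + 1)`. -/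
def pathEdge (k : ℕ) (γ : Path) : Edge k := γ.1 k

/-- The vertex of a path at level `-k`. -/
def pathVertex (k : ℕ) (γ : Path) : Vertex k := (pathEdge k γ).1.1

/-- A measure on the path space is ergodic when the filtration generated by the random path is
Kolmogorovian. -/
def IsErgodic (μ : Measure Path) : Prop :=
  IsKolmogorovian μ (generatedFiltration pathEdge)

end PascalGraph

end PascalWalk

/-! Enlarge the space by independent maps, one at each depth, assigning to every vertex a step drawn
from the transition law there. At the vertex actually visited, replace the drawn step by the step
really taken. By the Markov property this correction does not change the law of the map, and the
corrected map `W k` is independent of everything earlier, both for `V` and for `W`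
(`indep_stepMap`). Since `V k` is a function of `W k` and `V (k + 1)`, the maps form a
parameterization.

It is generating because the maps are monotone: a step lowers the state by at most one, so
evolutions driven by the same maps never cross. Hence the mean distance between two of them is the
difference of their means `m x` and `m y` (`integral_abs_flow_sub_flow`). Now `m (V (k + n))` is the
conditional expectation of `V k` given the past up to depth `k + n`. The tail of the vertex process
is trivial, being contained in that of the path, so reverse martingale convergence sends this to the
constant mean of `V k`. Starting the evolution from the best deterministic `x` therefore
approximates `V k` in L¹ by functions of the maps alone (`exists_integral_abs_sub_flow_le`).

Standardness follows: the maps are independent, and immersion holds because the new information `W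
k` is independent of the joint past (`condIndepGiven_of_indep`). -/

namespace PascalWalk

open Filter Topology
open scoped ENNReal

/-! ### Reverse martingales with a trivial tail -/

section ReverseMartingale

variable {Ω : Type*} {m0 : MeasurableSpace Ω} {P : Measure Ω}

/-- A function which is almost surely equal to an `F n`-measurable function for every `n` is almost
surely equal to a tail-measurable function. -/
lemma exists_measurable_iInf_ae_eq {F : ℕ → MeasurableSpace Ω} (hF : Antitone F) {f : Ω → ℝ}
    (hf : ∀ n, ∃ g : Ω → ℝ, Measurable[F n] g ∧ f =ᵐ[P] g) :
    ∃ h : Ω → ℝ, Measurable[⨅ n, F n] h ∧ f =ᵐ[P] h := by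
  choose g hg hfg using hf
  refine ⟨fun ω => limsup (fun n => g n ω) atTop, ?_, ?_⟩
  · intro s hs
    rw [MeasurableSpace.measurableSet_iInf]
    intro N
    -- A limsup ignores its first `N` terms, and all later ones are `F N`-measurable.
    have h : (fun ω => limsup (fun n => g n ω) atTop) =
        fun ω => limsup (fun n => g (n + N) ω) atTop := by
      funext ω
      exact (limsup_nat_add (fun n => g n ω) N).symm
    rw [h]
    have hm : Measurable[F N] fun ω => limsup (fun n => g (n + N) ω) atTop :=
      @Measurable.limsup ℝ Ω _ _ _ (F N) _ _ _ _
        (fun n => (hg (n + N)).mono (hF (Nat.le_add_left N n)) le_rfl)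
    exact hm hs
  · filter_upwards [ae_all_iff.2 hfg] with ω hω
    simp [← hω]

/-- Countably many Borel sets separate the points of the line, and the preimage of each has
probability 0 or 1. -/
lemma exists_ae_eq_const_of_isKolmogorovian [IsProbabilityMeasure P] {F : ℕ → MeasurableSpace Ω}
    (hle : ∀ n, F n ≤ m0) (hK : IsKolmogorovian P F) {h : Ω → ℝ} (hh : Measurable[⨅ n, F n] h) :
    ∃ c : ℝ, h =ᵐ[P] fun _ => c := by
  refine exists_eventuallyEq_const_of_forall_separating MeasurableSet fun U hU => ?_
  have hm : MeasurableSet (h ⁻¹' U) := (iInf_le F 0).trans (hle 0) _ (hh hU)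
  rcases hK _ (hh hU) with h0 | h1
  · exact Or.inr (measure_eq_zero_iff_ae_notMem.1 h0)
  · exact Or.inl ((mem_ae_iff_prob_eq_one hm).2 h1)

/-- Convergence of reverse martingales, when the tail σ-field is degenerate. -/
theorem tendsto_eLpNorm_condExp_sub_integral [IsProbabilityMeasure P] {F : ℕ → MeasurableSpace Ω}
    (hF : Antitone F) (hle : ∀ n, F n ≤ m0) (hK : IsKolmogorovian P F) {f : Ω → ℝ}
    (hf : MemLp f 2 P) :
    Tendsto (fun n => eLpNorm (P[f|F n] - fun _ => ∫ ω, f ω ∂P) 2 P) atTop (𝓝 0) := by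
  have : ∀ n, Fact (F n ≤ m0) := fun n => ⟨hle n⟩
  set K : ℕ → Submodule ℝ (Lp ℝ 2 P) := fun n => lpMeas ℝ ℝ (F n) 2 P with hKdef
  have : ∀ n, (K n).HasOrthogonalProjection := fun n => by
    simp only [hKdef]; infer_instance
  have hKanti : Antitone K := by
    intro i j hij x hx
    rw [hKdef, mem_lpMeas_iff_aestronglyMeasurable] at hx ⊢
    exact hx.mono (hF hij)
  have hU : Monotone fun n => (K n)ᗮ := fun i j hij => Submodule.orthogonal_le (hKanti hij)
  have hconst : ∀ x : Lp ℝ 2 P, (∀ n, x ∈ K n) → ∃ c : ℝ, x =ᵐ[P] fun _ => c := by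
    intro x hx
    obtain ⟨h, hh, hxh⟩ := exists_measurable_iInf_ae_eq (P := P) hF (f := x) fun n => by
      have := hx n
      rw [hKdef, mem_lpMeas_iff_aestronglyMeasurable] at this
      obtain ⟨g, hg, hxg⟩ := this
      exact ⟨g, hg.measurable, hxg⟩
    obtain ⟨c, hc⟩ := exists_ae_eq_const_of_isKolmogorovian hle hK hh
    exact ⟨c, hxh.trans hc⟩
  set c := ∫ ω, f ω ∂P with hc
  have hfc : MemLp (fun ω => f ω - c) 2 P := hf.sub (memLp_const c)
  set y : Lp ℝ 2 P := hfc.toLp with hy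
  -- The intersection of the `K n` consists of constants, and `f - c` is centered, hence orthogonal
  -- to it.
  have hyperp : y ∈ (⨆ n, (K n)ᗮ).topologicalClosure := by
    rw [← Submodule.orthogonal_orthogonal_eq_closure, Submodule.mem_orthogonal]
    intro x hx
    have hx' : ∀ n, x ∈ K n := fun n => by
      have : x ∈ (K n)ᗮᗮ :=
        Submodule.orthogonal_le (le_iSup (fun n => (K n)ᗮ) n) hx
      rwa [Submodule.orthogonal_orthogonal] at this
    obtain ⟨d, hd⟩ := hconst x hx'
    rw [L2.inner_def]
    have : (fun a => inner ℝ (x a) (y a)) =ᵐ[P] fun ω => d * (f ω - c) := by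
      filter_upwards [hd, hfc.coeFn_toLp] with ω h1 h2
      rw [h1, hy, h2]
      simp [mul_comm]
    rw [integral_congr_ae this, integral_const_mul, integral_sub (hf.integrable one_le_two)
      (integrable_const c)]
    simp [hc]
  have hlim := Submodule.starProjection_tendsto_closure_iSup (fun n => (K n)ᗮ) hU y
  rw [Submodule.starProjection_eq_self_iff.2 hyperp] at hlim
  -- The projections on the increasing spaces `(K n)ᗮ` converge to `y`; the complementary
  -- projections vanish in the limit.
  have hlim2 : Tendsto (fun n => ‖(K n).starProjection y‖) atTop (𝓝 0) := by
    have h3 := (tendsto_const_nhds (x := y)).sub hlim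
    rw [sub_self] at h3
    have h4 := h3.norm
    rw [norm_zero] at h4
    refine h4.congr fun n => ?_
    rw [Submodule.starProjection_orthogonal_val, sub_sub_cancel]
  have hlim3 := (ENNReal.continuous_ofReal.tendsto 0).comp hlim2
  rw [ENNReal.ofReal_zero] at hlim3
  refine hlim3.congr fun n => ?_
  have h5 : (((K n).starProjection y : Lp ℝ 2 P) : Ω → ℝ) =ᵐ[P] P[f|F n] - fun _ => c := by
    have h6 := hfc.condExpL2_ae_eq_condExp (𝕜 := ℝ) (hle n)
    have h7 : P[fun ω => f ω - c|F n] =ᵐ[P] P[f|F n] - P[fun _ => c|F n] :=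
      condExp_sub (hf.integrable one_le_two) (integrable_const c) (F n)
    rw [condExp_const (hle n) c] at h7
    exact EventuallyEq.trans h6 h7
  simp only [Function.comp]
  rw [Lp.norm_def, ENNReal.ofReal_toReal (Lp.eLpNorm_ne_top _), eLpNorm_congr_ae h5]

end ReverseMartingale

/-! ### Independence of joins of σ-fields -/

section Independence

variable {Ω : Type*} {m0 : MeasurableSpace Ω} {P : Measure Ω}

lemma isPiSystem_image2_inter {m₁ m₂ : MeasurableSpace Ω} :
    IsPiSystem {s : Set Ω | ∃ A B, MeasurableSet[m₁] A ∧ MeasurableSet[m₂] B ∧ s = A ∩ B} := by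
  rintro _ ⟨A, B, hA, hB, rfl⟩ _ ⟨A', B', hA', hB', rfl⟩ -
  refine ⟨A ∩ A', B ∩ B', hA.inter hA', hB.inter hB', ?_⟩
  ext; simp; tauto

lemma sup_eq_generateFrom_inter (m₁ m₂ : MeasurableSpace Ω) :
    m₁ ⊔ m₂ = MeasurableSpace.generateFrom
      {s : Set Ω | ∃ A B, MeasurableSet[m₁] A ∧ MeasurableSet[m₂] B ∧ s = A ∩ B} := by
  apply le_antisymm
  · refine sup_le (fun s hs => ?_) (fun s hs => ?_)
    · exact MeasurableSpace.measurableSet_generateFrom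
        ⟨s, Set.univ, hs, MeasurableSet.univ, by simp⟩
    · exact MeasurableSpace.measurableSet_generateFrom
        ⟨Set.univ, s, MeasurableSet.univ, hs, by simp⟩
  · refine MeasurableSpace.generateFrom_le ?_
    rintro _ ⟨A, B, hA, hB, rfl⟩
    exact MeasurableSet.inter ((le_sup_left : m₁ ≤ m₁ ⊔ m₂) _ hA)
      ((le_sup_right : m₂ ≤ m₁ ⊔ m₂) _ hB)

lemma indep_sup_right_of_inter [IsProbabilityMeasure P] {m m₁ m₂ : MeasurableSpace Ω} (hm : m ≤ m0)
    (hm₁ : m₁ ≤ m0) (hm₂ : m₂ ≤ m0)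
    (h : ∀ S A B, MeasurableSet[m] S → MeasurableSet[m₁] A → MeasurableSet[m₂] B →
      P (S ∩ (A ∩ B)) = P S * P (A ∩ B)) : Indep m (m₁ ⊔ m₂) P := by
  refine IndepSets.indep (p1 := {s | MeasurableSet[m] s}) hm (sup_le hm₁ hm₂)
    (@MeasurableSpace.isPiSystem_measurableSet _ m) isPiSystem_image2_inter
    (@MeasurableSpace.generateFrom_measurableSet _ m).symm (sup_eq_generateFrom_inter m₁ m₂) ?_
  rw [IndepSets_iff]
  rintro S _ hS ⟨A, B, hA, hB, rfl⟩
  exact h S A B hS hA hB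

lemma Indep.sup_assoc [IsProbabilityMeasure P] {m₁ m₂ m₃ : MeasurableSpace Ω} (h₁ : m₁ ≤ m0)
    (h₂ : m₂ ≤ m0) (h₃ : m₃ ≤ m0) (h : Indep m₁ (m₂ ⊔ m₃) P) (h' : Indep m₂ m₃ P) :
    Indep (m₁ ⊔ m₂) m₃ P := by
  refine Indep.symm (indep_sup_right_of_inter h₃ h₁ h₂ fun S A B hS hA hB => ?_)
  rw [Indep_iff] at h h'
  have hB' : MeasurableSet[m₂ ⊔ m₃] B := (le_sup_left : m₂ ≤ m₂ ⊔ m₃) _ hB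
  have hS' : MeasurableSet[m₂ ⊔ m₃] S := (le_sup_right : m₃ ≤ m₂ ⊔ m₃) _ hS
  rw [show S ∩ (A ∩ B) = A ∩ (B ∩ S) by ext; simp; tauto, h A _ hA (hB'.inter hS'),
    h' B S hB hS, h A B hA hB']
  ring

/-- Random variables, each of which is independent of all the following ones, are independent. -/
lemma iIndepFun_of_indep_generatedFiltration [IsProbabilityMeasure P] {E : ℕ → Type*}
    [∀ k, MeasurableSpace (E k)] {X : ∀ k, Ω → E k}
    (h : ∀ k, Indep (MeasurableSpace.comap (X k) inferInstance)
      (generatedFiltration X (k + 1)) P) : iIndepFun X P := by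
  rw [iIndepFun_iff]
  intro S
  induction S using Finset.induction_on_min with
  | empty => simp
  | insert a S ha ih =>
    intro f hf
    have hS : MeasurableSet[generatedFiltration X (a + 1)] (⋂ i ∈ S, f i) := by
      refine Finset.measurableSet_biInter _ fun i hi => ?_
      exact (le_iSup₂ (f := fun j (_ : j ≥ a + 1) =>
        MeasurableSpace.comap (X j) inferInstance) i (ha i hi)) _
        (hf i (Finset.mem_insert_of_mem hi))
    have hna : a ∉ S := fun hmem => lt_irrefl _ (ha a hmem)
    rw [Finset.set_biInter_insert, Finset.prod_insert hna,
      (Indep_iff _ _ _).1 (h a) _ _ (hf a (Finset.mem_insert_self _ _)) hS,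
      ih fun i hi => hf i (Finset.mem_insert_of_mem hi)]

end Independence

/-! ### Conditional independence from an independent innovation -/

section Immersion

variable {Ω : Type*}

lemma condExp_inter_ae_eq_of_indep {F G mS m0 : MeasurableSpace Ω} {P : Measure Ω}
    [IsProbabilityMeasure P]
    (hF : F ≤ m0) (hG : G ≤ m0) (hS : mS ≤ m0) (h : Indep mS (F ⊔ G) P) {S B : Set Ω}
    (hSm : MeasurableSet[mS] S) (hB : MeasurableSet[G] B) :
    P⟦S ∩ B | F⟧ =ᵐ[P] fun ω => P.real S * (P⟦B | F⟧) ω := by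
  have hint : ∀ T : Set Ω, MeasurableSet T → Integrable (T.indicator fun _ => (1 : ℝ)) P :=
    fun T hT => (integrable_const 1).indicator hT
  refine (ae_eq_condExp_of_forall_setIntegral_eq hF (hint _ ((hS _ hSm).inter (hG _ hB)))
    (fun s _ _ => (integrable_condExp.const_mul _).integrableOn) (fun C hC _ => ?_)
    (stronglyMeasurable_condExp.const_mul _).aestronglyMeasurable).symm
  rw [integral_const_mul, setIntegral_condExp hF (hint _ (hG _ hB)) hC,
    setIntegral_indicator (hG _ hB), setIntegral_indicator ((hS _ hSm).inter (hG _ hB))]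
  simp only [integral_const, smul_eq_mul, mul_one, measureReal_restrict_apply_univ]
  rw [show C ∩ (S ∩ B) = S ∩ (C ∩ B) by ext; simp; tauto]
  have hCB : MeasurableSet[F ⊔ G] (C ∩ B) :=
    MeasurableSet.inter ((le_sup_left : F ≤ F ⊔ G) _ hC) ((le_sup_right : G ≤ F ⊔ G) _ hB)
  simp only [measureReal_def]
  rw [(Indep_iff _ _ _).1 h S _ hSm hCB, ENNReal.toReal_mul]

/-- A σ-field which is determined by `F` and an independent information is conditionally independent
given `F` of everything that precedes this information. -/
lemma condIndepGiven_of_indep {F G m mS m0 : MeasurableSpace Ω} [StandardBorelSpace Ω]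
    {P : Measure Ω} [IsProbabilityMeasure P] (hF : F ≤ m0) (hG : G ≤ m0) (hS : mS ≤ m0)
    (hm : m ≤ F ⊔ mS) (h : Indep mS (F ⊔ G) P) : CondIndepGiven P F m G := by
  have key : CondIndep F (F ⊔ mS) G hF P := by
    refine CondIndepSets.condIndep (sup_le hF hS) hG isPiSystem_image2_inter
      (@MeasurableSpace.isPiSystem_measurableSet _ G) (sup_eq_generateFrom_inter F mS)
      (@MeasurableSpace.generateFrom_measurableSet _ G).symm ?_
    refine (condIndepSets_iff F hF _ {s | MeasurableSet[G] s} ?_ (fun s hs => hG _ hs) P).2 ?_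
    · rintro _ ⟨A, S, hA, hSm, rfl⟩
      exact (hF _ hA).inter (hS _ hSm)
    rintro _ B ⟨A, S, hA, hSm, rfl⟩ hB
    have hSi : Integrable (S.indicator fun _ => (1 : ℝ)) P :=
      (integrable_const 1).indicator (hS _ hSm)
    have hSBi : Integrable ((S ∩ B).indicator fun _ => (1 : ℝ)) P :=
      (integrable_const 1).indicator ((hS _ hSm).inter (hG _ hB))
    have e1 := condExp_indicator hSi hA
    have e2 := condExp_indicator hSBi hA
    rw [Set.indicator_indicator] at e1 e2
    have e3 := condExp_inter_ae_eq_of_indep hF hG hS h hSm hB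
    -- The case of the sure event says that the conditional probability of `S` given `F` is the
    -- constant `P.real S`.
    have e4 := condExp_inter_ae_eq_of_indep hF hG hS h hSm (MeasurableSet.univ (m := G))
    rw [Set.inter_univ, Set.indicator_univ, condExp_const hF] at e4
    rw [Set.inter_assoc]
    filter_upwards [e1, e2, e3, e4] with ω h1 h2 h3 h4
    rw [Pi.mul_apply, h1, h2]
    by_cases hω : ω ∈ A <;> simp [hω, h3, h4]
  intro A B hA hB
  exact (condIndep_iff F _ G hF (sup_le hF hS) hG P).1 key A B (hm _ hA) hB

end Immersion

/-! ### Averaging a random function at an independent point -/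

section Freezing

variable {Ω : Type*}

lemma setIntegral_apply_fin {m0 : MeasurableSpace Ω} {P : Measure Ω} {N : ℕ} {X : Ω → Fin N} (hX : Measurable X) {g : Fin N → Ω → ℝ}
    (hg : ∀ x, Integrable (g x) P) (C : Set Ω) :
    ∫ ω in C, g (X ω) ω ∂P = ∑ x, ∫ ω in C ∩ X ⁻¹' {x}, g x ω ∂P := by
  have hm : ∀ x, MeasurableSet (X ⁻¹' {x}) := fun x => hX (measurableSet_singleton x)
  have : (fun ω => g (X ω) ω) = fun ω => ∑ x, (X ⁻¹' {x}).indicator (g x) ω := by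
    funext ω
    rw [Finset.sum_eq_single (X ω)]
    · simp
    · intro b _ hb
      exact Set.indicator_of_notMem (fun h => hb h.symm) _
    · simp
  rw [this, integral_finsetSum _ fun x _ => ((hg x).indicator (hm x)).integrableOn]
  exact Finset.sum_congr rfl fun x _ => setIntegral_indicator (hm x)

/-- In the expectation of a random function applied to an independent random variable, the function
may be averaged first. -/
lemma setIntegral_apply_of_indep {mB mF m0 : MeasurableSpace Ω} {P : Measure Ω}
    [IsProbabilityMeasure P]
    (hB : mB ≤ m0) (hF : mF ≤ m0) (h : Indep mB mF P) {N : ℕ} {X : Ω → Fin N}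
    (hX : Measurable[mF] X) {g : Fin N → Ω → ℝ} (hg : ∀ x, Measurable[mB] (g x))
    (hint : ∀ x, Integrable (g x) P) {C : Set Ω} (hC : MeasurableSet[mF] C) :
    ∫ ω in C, g (X ω) ω ∂P = ∫ ω in C, (∫ ω', g (X ω) ω' ∂P) ∂P := by
  have hX' : Measurable X := hX.mono hF le_rfl
  rw [setIntegral_apply_fin hX' hint C,
    setIntegral_apply_fin hX' (g := fun x _ => ∫ ω', g x ω' ∂P) (fun x => integrable_const _) C]
  refine Finset.sum_congr rfl fun x _ => ?_
  have hD : MeasurableSet[mF] (C ∩ X ⁻¹' {x}) := hC.inter (hX (measurableSet_singleton x))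
  rw [← setIntegral_condExp hF (hint x) hD]
  exact integral_congr_ae (ae_restrict_of_ae
    (condExp_indep_eq hB hF (hg x).stronglyMeasurable h))

lemma measurable_apply_nat [MeasurableSpace Ω] {f : Ω → ℕ → ℕ} (hf : ∀ x, Measurable fun ω => f ω x)
    {g : Ω → ℕ} (hg : Measurable g) : Measurable fun ω => f ω (g ω) := by
  refine measurable_to_countable' fun y => ?_
  have : (fun ω => f ω (g ω)) ⁻¹' {y} = ⋃ x, g ⁻¹' {x} ∩ (fun ω => f ω x) ⁻¹' {y} := by
    ext; simp
  rw [this]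
  exact MeasurableSet.iUnion fun x =>
    (hg (measurableSet_singleton x)).inter (hf x (measurableSet_singleton y))

end Freezing

lemma generatedFiltration_antitone {Ω : Type*} {E : ℕ → Type*} [∀ k, MeasurableSpace (E k)]
    (X : ∀ k, Ω → E k) : Antitone (generatedFiltration X) :=
  fun _ _ hij => biSup_mono fun _ hj => le_trans hij hj

lemma comap_le_generatedFiltration {Ω : Type*} {E : ℕ → Type*} [∀ k, MeasurableSpace (E k)]
    (X : ∀ k, Ω → E k) {k j : ℕ} (h : k ≤ j) :
    MeasurableSpace.comap (X j) inferInstance ≤ generatedFiltration X k :=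
  le_iSup₂ (f := fun j (_ : j ≥ k) => MeasurableSpace.comap (X j) inferInstance) j h

lemma generatedFiltration_le {Ω : Type*} [m0 : MeasurableSpace Ω] {E : ℕ → Type*}
    [∀ k, MeasurableSpace (E k)] {X : ∀ k, Ω → E k} (hX : ∀ k, Measurable (X k)) (k : ℕ) :
    generatedFiltration X k ≤ m0 :=
  iSup₂_le fun j _ => (hX j).comap_le

/-! ### Monotone coupling: the maps generate the process -/

section Coupling

variable {Ω : Type*} {T : ℕ → Type*}

/-- The state at depth `k` of the evolution driven by the maps `step j (W j)`, when it starts from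
the state `x` at depth `k + n`. -/
def flow (step : ∀ k, T k → ℕ → ℕ) (W : ∀ k, Ω → T k) (k : ℕ) : ℕ → Ω → ℕ → ℕ
  | 0, _, x => x
  | n + 1, ω, x => flow step W k n ω (step (k + n) (W (k + n) ω) x)

variable {step : ∀ k, T k → ℕ → ℕ} {W : ∀ k, Ω → T k}

lemma flow_mono (hmono : ∀ k t, Monotone (step k t)) (k n : ℕ) (ω : Ω) :
    Monotone (flow step W k n ω) := by
  induction n with
  | zero => exact monotone_id
  | succ n ih => exact ih.comp (hmono _ _)

lemma flow_le (hle : ∀ k t x, step k t x ≤ x) (k n : ℕ) (ω : Ω) (x : ℕ) :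
    flow step W k n ω x ≤ x := by
  induction n generalizing x with
  | zero => exact le_rfl
  | succ n ih => exact (ih _).trans (hle _ _ _)

lemma flow_eq {X : ℕ → Ω → ℕ} (hX : ∀ k ω, X k ω = step k (W k ω) (X (k + 1) ω)) (k n : ℕ)
    (ω : Ω) : flow step W k n ω (X (k + n) ω) = X k ω := by
  induction n with
  | zero => rfl
  | succ n ih => rw [flow, ← add_assoc, ← hX, ih]

/-- The σ-field generated by `W j` for `k ≤ j < k + n`. -/
@[reducible] def blockSigma [∀ k, MeasurableSpace (T k)] (W : ∀ k, Ω → T k) (k : ℕ) : ℕ → MeasurableSpace Ω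
  | 0 => ⊥
  | n + 1 => blockSigma W k n ⊔ MeasurableSpace.comap (W (k + n)) inferInstance

lemma blockSigma_le_generatedFiltration [∀ k, MeasurableSpace (T k)] (W : ∀ k, Ω → T k)
    (k n : ℕ) : blockSigma W k n ≤ generatedFiltration W k := by
  induction n with
  | zero => exact bot_le
  | succ n ih => exact sup_le ih (comap_le_generatedFiltration W (Nat.le_add_right k n))

lemma measurable_flow [∀ k, MeasurableSpace (T k)] [∀ k, DiscreteMeasurableSpace (T k)]
    (k n : ℕ) (x : ℕ) : Measurable[blockSigma W k n] fun ω => flow step W k n ω x := by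
  induction n generalizing x with
  | zero => exact @measurable_const _ _ _ (blockSigma W k 0) _
  | succ n ih =>
    refine @measurable_apply_nat _ (blockSigma W k (n + 1)) (flow step W k n) (fun y => ?_) _ ?_
    · exact (ih y).mono le_sup_left le_rfl
    · have h1 : Measurable[blockSigma W k (n + 1)] (W (k + n)) :=
        (comap_measurable (W (k + n))).mono le_sup_right le_rfl
      exact (Measurable.of_discrete (f := fun t => step (k + n) t x)).comp h1

/-- Induction on the length of the block: `Indep.sup_assoc` moves `W (k + n)` from the past into the
block, since it is itself independent of what precedes it. -/
lemma indep_blockSigma {S : ℕ → Type*} [∀ k, MeasurableSpace (S k)] [∀ k, MeasurableSpace (T k)]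
    [m0 : MeasurableSpace Ω] {P : Measure Ω} [IsProbabilityMeasure P]
    {V : ∀ k, Ω → S k} (hV : ∀ k, Measurable (V k)) (hW : ∀ k, Measurable (W k))
    (hind : ∀ k, Indep (MeasurableSpace.comap (W k) inferInstance)
      (generatedFiltration V (k + 1) ⊔ generatedFiltration W (k + 1)) P) (k n : ℕ) :
    Indep (blockSigma W k n) (generatedFiltration V (k + n) ⊔ generatedFiltration W (k + n)) P := by
  induction n with
  | zero => exact indep_bot_left _
  | succ n ih =>
    refine Indep.sup_assoc ((blockSigma_le_generatedFiltration W k n).trans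
      (generatedFiltration_le hW k)) (hW _).comap_le
      (sup_le (generatedFiltration_le hV _) (generatedFiltration_le hW _)) ?_ (hind (k + n))
    refine indep_of_indep_of_le_right ih (sup_le ?_ (sup_le ?_ ?_))
    · exact (comap_le_generatedFiltration W le_rfl).trans le_sup_right
    · exact (generatedFiltration_antitone V (Nat.le_succ _)).trans le_sup_left
    · exact (generatedFiltration_antitone W (Nat.le_succ _)).trans le_sup_right

lemma subsetAE_of_ae_tendsto {m : MeasurableSpace Ω} [m0 : MeasurableSpace Ω] {P : Measure Ω}
    {f : ℕ → Ω → ℝ} (hf : ∀ n, Measurable[m] (f n)) {g : Ω → ℝ}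
    (hfg : ∀ᵐ ω ∂P, Tendsto (fun n => f n ω) atTop (𝓝 (g ω))) :
    SubsetAE P (MeasurableSpace.comap g inferInstance) m := by
  have hm : Measurable[m] fun ω => limsup (fun n => f n ω) atTop :=
    @Measurable.limsup ℝ Ω _ _ _ m _ _ _ _ hf
  have hae : g =ᵐ[P] fun ω => limsup (fun n => f n ω) atTop := by
    filter_upwards [hfg] with ω hω using hω.limsup_eq.symm
  rintro _ ⟨s, hs, rfl⟩
  exact EventuallyMeasurable.congr (hm.eventuallyMeasurable) hae hs

section Expectation

variable [∀ k, MeasurableSpace (T k)] [∀ k, DiscreteMeasurableSpace (T k)] [m0 : MeasurableSpace Ω]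
  {P : Measure Ω} [IsProbabilityMeasure P]

lemma integrable_flow (hW : ∀ k, Measurable (W k)) (hle : ∀ k t x, step k t x ≤ x) (k n x : ℕ) :
    Integrable (fun ω => (flow step W k n ω x : ℝ)) P := by
  have h1 : Measurable fun ω => flow step W k n ω x :=
    (measurable_flow k n x).mono ((blockSigma_le_generatedFiltration W k n).trans
      (generatedFiltration_le hW k)) le_rfl
  have h2 : Measurable fun ω => (flow step W k n ω x : ℝ) := measurable_from_nat.comp h1
  refine Integrable.of_bound h2.aestronglyMeasurable (x : ℝ) (Eventually.of_forall fun ω => ?_)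
  simpa using flow_le hle k n ω x

/-- By monotonicity the sign of the difference is the same for every `ω`, so the absolute value
leaves the integral. -/
lemma integral_abs_flow_sub_flow (hW : ∀ k, Measurable (W k)) (hle : ∀ k t x, step k t x ≤ x)
    (hmono : ∀ k t, Monotone (step k t)) (k n x y : ℕ) :
    ∫ ω, |(flow step W k n ω x : ℝ) - flow step W k n ω y| ∂P =
      |∫ ω, (flow step W k n ω x : ℝ) ∂P - ∫ ω, (flow step W k n ω y : ℝ) ∂P| := by
  have key : ∀ x y, x ≤ y → ∫ ω, |(flow step W k n ω x : ℝ) - flow step W k n ω y| ∂P =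
      |∫ ω, (flow step W k n ω x : ℝ) ∂P - ∫ ω, (flow step W k n ω y : ℝ) ∂P| := by
    intro x y hxy
    have h1 : ∀ ω, (flow step W k n ω x : ℝ) ≤ flow step W k n ω y := fun ω => by
      exact_mod_cast flow_mono hmono k n ω hxy
    have hx := integrable_flow (P := P) hW hle k n x
    have hy := integrable_flow (P := P) hW hle k n y
    rw [abs_sub_comm, abs_of_nonneg (sub_nonneg.2 (integral_mono hx hy h1)),
      ← integral_sub hy hx]
    refine integral_congr_ae (Eventually.of_forall fun ω => ?_)
    simp only
    rw [abs_sub_comm, abs_of_nonneg (sub_nonneg.2 (h1 ω))]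
  rcases le_total x y with h | h
  · exact key x y h
  · rw [abs_sub_comm, ← key y x h]
    simp only [abs_sub_comm]

variable {V : ∀ k, Ω → Fin (k + 1)}

/-- `V k` is the flow evaluated at `V (k + n)`, and the flow is independent of the past up to that
depth; conditioning thus averages the flow with its starting point frozen. -/
lemma condExp_eq_integral_flow (hV : ∀ k, Measurable (V k)) (hW : ∀ k, Measurable (W k))
    (hle : ∀ k t x, step k t x ≤ x)
    (hrec : ∀ k ω, (V k ω : ℕ) = step k (W k ω) (V (k + 1) ω))
    (hind : ∀ k, Indep (MeasurableSpace.comap (W k) inferInstance)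
      (generatedFiltration V (k + 1) ⊔ generatedFiltration W (k + 1)) P) (k n : ℕ) :
    (fun ω => ∫ ω', (flow step W k n ω' (V (k + n) ω) : ℝ) ∂P) =ᵐ[P]
      P[fun ω => ((V k ω : ℕ) : ℝ)|generatedFiltration V (k + n)] := by
  have hB : blockSigma W k n ≤ m0 :=
    (blockSigma_le_generatedFiltration W k n).trans (generatedFiltration_le hW k)
  have hF := generatedFiltration_le hV (k + n)
  have hXF : Measurable[generatedFiltration V (k + n)] (V (k + n)) :=
    (comap_measurable (V (k + n))).mono (comap_le_generatedFiltration V le_rfl) le_rfl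
  have hmeas : Measurable[generatedFiltration V (k + n)]
      fun ω => ∫ ω', (flow step W k n ω' (V (k + n) ω) : ℝ) ∂P :=
    (Measurable.of_discrete (f := fun x : Fin (k + n + 1) =>
      ∫ ω', (flow step W k n ω' x : ℝ) ∂P)).comp hXF
  have hflow : ∀ ω, ((V k ω : ℕ) : ℝ) = flow step W k n ω (V (k + n) ω) := fun ω => by
    rw [flow_eq (X := fun k ω => (V k ω : ℕ)) hrec k n ω]
  have hVint : ∀ k, Integrable (fun ω => ((V k ω : ℕ) : ℝ)) P := fun k => by
    refine Integrable.of_bound (((Measurable.of_discrete (f := fun x : Fin (k + 1) =>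
      ((x : ℕ) : ℝ))).comp (hV k)).aestronglyMeasurable) (k : ℝ) (Eventually.of_forall fun ω => ?_)
    simpa using (V k ω).is_le
  refine ae_eq_condExp_of_forall_setIntegral_eq hF (hVint k) (fun s _ _ => ?_) (fun C hC _ => ?_)
    hmeas.aestronglyMeasurable
  · refine (Integrable.of_bound (hmeas.mono hF le_rfl).aestronglyMeasurable
      ((k + n : ℕ) : ℝ) (Eventually.of_forall fun ω => ?_)).integrableOn
    refine (norm_integral_le_of_norm_le_const (C := ((k + n : ℕ) : ℝ))
      (Eventually.of_forall fun ω' => ?_)).trans (by simp)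
    rw [Real.norm_natCast]
    exact_mod_cast (flow_le hle k n ω' _).trans (V (k + n) ω).is_le
  · simp only [hflow]
    refine (setIntegral_apply_of_indep hB hF (indep_of_indep_of_le_right
      (indep_blockSigma hV hW hind k n) le_sup_left) hXF
      (g := fun x ω => (flow step W k n ω x : ℝ)) (fun x => ?_) (fun x => ?_) hC).symm
    · exact measurable_from_nat.comp (measurable_flow k n x)
    · exact integrable_flow hW hle k n x

/-- The left side is the mean of `|m x - m (V (k + n))|`, where `m` is the mean of the flow.
Choosing `x` with `m x` closest to `c` among the possible states gives `|m x - c| ≤ |m (V (k + n)) -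
c|`, and the triangle inequality produces the factor 2. -/
lemma exists_integral_abs_sub_flow_le (hV : ∀ k, Measurable (V k)) (hW : ∀ k, Measurable (W k))
    (hle : ∀ k t x, step k t x ≤ x) (hmono : ∀ k t, Monotone (step k t))
    (hrec : ∀ k ω, (V k ω : ℕ) = step k (W k ω) (V (k + 1) ω))
    (hind : ∀ k, Indep (MeasurableSpace.comap (W k) inferInstance)
      (generatedFiltration V (k + 1) ⊔ generatedFiltration W (k + 1)) P) (k n : ℕ) (c : ℝ) :
    ∃ x : ℕ, ∫ ω, |(flow step W k n ω x : ℝ) - (V k ω : ℕ)| ∂P ≤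
      2 * ∫ ω, |P[fun ω => ((V k ω : ℕ) : ℝ)|generatedFiltration V (k + n)] ω - c| ∂P := by
  have hB : blockSigma W k n ≤ m0 :=
    (blockSigma_le_generatedFiltration W k n).trans (generatedFiltration_le hW k)
  have hF := generatedFiltration_le hV (k + n)
  have hXF : Measurable[generatedFiltration V (k + n)] (V (k + n)) :=
    (comap_measurable (V (k + n))).mono (comap_le_generatedFiltration V le_rfl) le_rfl
  set m : ℕ → ℝ := fun x => ∫ ω, (flow step W k n ω x : ℝ) ∂P with hm
  obtain ⟨x, -, hx⟩ := Finset.exists_min_image (Finset.univ : Finset (Fin (k + n + 1)))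
    (fun x => |m x - c|) Finset.univ_nonempty
  refine ⟨x, ?_⟩
  have hdom : ∀ f : Fin (k + n + 1) → ℝ, Integrable (fun ω => f (V (k + n) ω)) P := fun f => by
    obtain ⟨C, hC⟩ := (Set.finite_range fun x => ‖f x‖).bddAbove
    exact Integrable.of_bound ((Measurable.of_discrete (f := f)).comp
      (hV _)).aestronglyMeasurable C (Eventually.of_forall fun ω => hC ⟨_, rfl⟩)
  have e1 : ∫ ω, |(flow step W k n ω x : ℝ) - (V k ω : ℕ)| ∂P =
      ∫ ω, |m x - m (V (k + n) ω)| ∂P := by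
    have h1 := setIntegral_apply_of_indep (P := P) hB hF (indep_of_indep_of_le_right
      (indep_blockSigma hV hW hind k n) le_sup_left) hXF
      (g := fun y ω => |(flow step W k n ω x : ℝ) - flow step W k n ω y|) (fun y => ?_)
      (fun y => ?_) MeasurableSet.univ
    · simp only [Measure.restrict_univ] at h1
      simp only [hm, ← integral_abs_flow_sub_flow (P := P) hW hle hmono]
      rw [← h1]
      refine integral_congr_ae (Eventually.of_forall fun ω => ?_)
      simp only
      rw [flow_eq (X := fun k ω => (V k ω : ℕ)) hrec k n ω]
    · have h2 : ∀ z, Measurable[blockSigma W k n] fun ω => (flow step W k n ω z : ℝ) :=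
        fun z => measurable_from_nat.comp (measurable_flow k n z)
      exact measurable_norm.comp ((h2 x).sub (h2 y))
    · exact ((integrable_flow hW hle k n x).sub (integrable_flow hW hle k n y)).abs
  have e2 : ∫ ω, |P[fun ω => ((V k ω : ℕ) : ℝ)|generatedFiltration V (k + n)] ω - c| ∂P =
      ∫ ω, |m (V (k + n) ω) - c| ∂P := by
    refine integral_congr_ae ?_
    filter_upwards [condExp_eq_integral_flow hV hW hle hrec hind k n] with ω hω
    rw [← hω]
  rw [e1, e2, ← integral_const_mul]
  refine integral_mono (hdom fun y => |m x - m y|) ((hdom fun y => |m y - c|).const_mul 2)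
    fun ω => ?_
  have h3 := hx (V (k + n) ω) (Finset.mem_univ _)
  have h4 := abs_sub_le (m x) c (m (V (k + n) ω))
  rw [abs_sub_comm c] at h4
  simp only
  linarith

/-- A Kolmogorovian process with a monotone representation by independent maps is generated by these
maps. -/
theorem subsetAE_generatedFiltration_of_monotone (hV : ∀ k, Measurable (V k))
    (hW : ∀ k, Measurable (W k))
    (hle : ∀ k t x, step k t x ≤ x) (hmono : ∀ k t, Monotone (step k t))
    (hrec : ∀ k ω, (V k ω : ℕ) = step k (W k ω) (V (k + 1) ω))
    (hind : ∀ k, Indep (MeasurableSpace.comap (W k) inferInstance)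
      (generatedFiltration V (k + 1) ⊔ generatedFiltration W (k + 1)) P)
    (hK : IsKolmogorovian P (generatedFiltration V)) (k : ℕ) :
    SubsetAE P (generatedFiltration V k) (generatedFiltration W k) := by
  have main : ∀ k, SubsetAE P (MeasurableSpace.comap (V k) inferInstance)
      (generatedFiltration W k) := by
    intro k
    set f : Ω → ℝ := fun ω => ((V k ω : ℕ) : ℝ) with hf
    have hfm : Measurable f := (Measurable.of_discrete (f := fun x : Fin (k + 1) =>
      ((x : ℕ) : ℝ))).comp (hV k)
    have hf2 : MemLp f 2 P := MemLp.of_bound hfm.aestronglyMeasurable (k : ℝ)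
      (Eventually.of_forall fun ω => by simpa [hf] using (V k ω).is_le)
    set c := ∫ ω, f ω ∂P
    have hfi := hf2.integrable one_le_two
    choose x hx using fun n =>
      exists_integral_abs_sub_flow_le hV hW hle hmono hrec hind k n c
    -- Dropping the first `k` terms of a decreasing sequence does not change its tail.
    have hK' : IsKolmogorovian P fun n => generatedFiltration V (k + n) := by
      intro s hs
      refine hK s ?_
      rw [MeasurableSpace.measurableSet_iInf] at hs ⊢
      exact fun n => generatedFiltration_antitone V (Nat.le_add_left n k) _ (hs n)
    have hlim := tendsto_eLpNorm_condExp_sub_integral (P := P)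
      (fun i j hij => generatedFiltration_antitone V (Nat.add_le_add_left hij k))
      (fun n => generatedFiltration_le hV (k + n)) hK' hf2
    have hlim2 : Tendsto (fun n => eLpNorm ((fun ω => (flow step W k n ω (x n) : ℝ)) - f) 1 P)
        atTop (𝓝 0) := by
      have hlim3 := ENNReal.Tendsto.const_mul (a := 2) hlim (Or.inr (by simp))
      rw [mul_zero] at hlim3
      refine tendsto_of_tendsto_of_tendsto_of_le_of_le tendsto_const_nhds hlim3
        (fun _ => zero_le) fun n => ?_
      have hi1 := (integrable_flow (P := P) hW hle k n (x n)).sub hfi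
      have hi2 : Integrable (P[f|generatedFiltration V (k + n)] - fun _ => c) P :=
        integrable_condExp.sub (integrable_const c)
      refine le_trans ?_ (mul_le_mul_right (eLpNorm_le_eLpNorm_of_exponent_le one_le_two
        hi2.aestronglyMeasurable) _)
      rw [eLpNorm_one_eq_lintegral_enorm, eLpNorm_one_eq_lintegral_enorm,
        ← ofReal_integral_norm_eq_lintegral_enorm hi1,
        ← ofReal_integral_norm_eq_lintegral_enorm hi2, ← ENNReal.ofReal_ofNat 2,
        ← ENNReal.ofReal_mul zero_le_two]
      exact ENNReal.ofReal_le_ofReal (hx n)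
    have hmeas : ∀ n, Measurable[generatedFiltration W k]
        fun ω => (flow step W k n ω (x n) : ℝ) := fun n =>
      (measurable_from_nat.comp (measurable_flow k n (x n))).mono
        (blockSigma_le_generatedFiltration W k n) le_rfl
    -- L¹ convergence yields an almost sure limit along a subsequence, which is enough for
    -- measurability up to null sets.
    obtain ⟨ns, -, hns⟩ := (tendstoInMeasure_of_tendsto_eLpNorm one_ne_zero
      (fun n => ((hmeas n).mono (generatedFiltration_le hW k) le_rfl).aestronglyMeasurable)
      hfm.aestronglyMeasurable hlim2).exists_seq_tendsto_ae
    refine le_trans ?_ (subsetAE_of_ae_tendsto (fun i => hmeas (ns i)) hns)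
    rintro _ ⟨s, -, rfl⟩
    refine ⟨(fun x : Fin (k + 1) => ((x : ℕ) : ℝ)) '' s, (s.toFinite.image _).measurableSet, ?_⟩
    ext ω
    simp [hf, Fin.val_inj]
  refine iSup₂_le fun j hj => (main j).trans ?_
  rintro s ⟨t, ht, hst⟩
  exact ⟨t, generatedFiltration_antitone W hj _ ht, hst⟩

end Expectation

end Coupling

/-! ### Representation of the Markov process by independent maps -/

section Representation

/-- The maps of the states at level `-(k + 1)` to the steps which follow. -/
abbrev StepMap (k : ℕ) : Type := Vertex (k + 1) → Bool

/-- The next state: it decreases by one if the map of steps says so. -/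
def nextState (k : ℕ) (t : StepMap k) (x : ℕ) : ℕ := x - (t (Fin.ofNat (k + 2) x)).toNat

lemma nextState_le (k : ℕ) (t : StepMap k) (x : ℕ) : nextState k t x ≤ x := Nat.sub_le _ _

/-- Since a step is at most 1, the image of `x + 1` is at least `x`, which is at least the image of
`x`. This holds for every map `t`, and also outside the true range of states, where the index wraps
around. -/
lemma nextState_mono (k : ℕ) (t : StepMap k) : Monotone (nextState k t) := by
  refine monotone_nat_of_le_succ fun x => ?_
  have := Bool.toNat_le (t (Fin.ofNat (k + 2) (x + 1)))
  simp only [nextState]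
  omega

variable {Ω : Type*}

/-- The indicator of a downward step of the process `V` from depth `k + 1` to depth `k`. -/
def downStep (V : ∀ k, Ω → Vertex k) (k : ℕ) (ω : Ω) : Bool :=
  decide ((V k ω : ℕ) ≠ V (k + 1) ω)

/-- The maps of steps, corrected so as to be compatible with the steps of the process. -/
def stepMap (V : ∀ k, Ω → Vertex k) (k : ℕ) (ω : Ω × ∀ k, StepMap k) : StepMap k :=
  Function.update (ω.2 k) (V (k + 1) ω.1) (downStep V k ω.1)

lemma eq_nextState_stepMap {V : ∀ k, Ω → Vertex k}
    (hstep : ∀ k ω, (V (k + 1) ω : ℕ) = V k ω ∨ (V (k + 1) ω : ℕ) = V k ω + 1)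
    (k : ℕ) (ω : Ω × ∀ k, StepMap k) :
    (V k ω.1 : ℕ) = nextState k (stepMap V k ω) (V (k + 1) ω.1) := by
  rw [nextState, Fin.ofNat_val_eq_self, stepMap, Function.update_self, downStep]
  rcases hstep k ω.1 with h | h <;> simp [h]

variable [m0 : MeasurableSpace Ω] {P : Measure Ω} {V : ∀ k, Ω → Vertex k}

lemma measurable_downStep (hV : ∀ k, Measurable (V k)) (k : ℕ) : Measurable (downStep V k) :=
  (Measurable.of_discrete (f := fun p : Vertex k × Vertex (k + 1) =>
    decide ((p.1 : ℕ) ≠ p.2))).comp ((hV k).prodMk (hV (k + 1)))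

open Classical in
/-- The conditional law of the step which follows the state `w`. -/
noncomputable def stepLaw (P : Measure Ω) (V : ∀ k, Ω → Vertex k) (k : ℕ) (w : Vertex (k + 1)) :
    Measure Bool :=
  -- At a state of probability zero any probability measure would do; one is needed to form the
  -- product laws.
  if P (V (k + 1) ⁻¹' {w}) = 0 then Measure.dirac false
  else (P[|V (k + 1) ⁻¹' {w}]).map (downStep V k)

lemma isProbabilityMeasure_stepLaw [IsProbabilityMeasure P] (hV : ∀ k, Measurable (V k)) (k : ℕ)
    (w : Vertex (k + 1)) : IsProbabilityMeasure (stepLaw P V k w) := by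
  unfold stepLaw
  split_ifs with h
  · infer_instance
  · have := cond_isProbabilityMeasure h
    exact Measure.isProbabilityMeasure_map (measurable_downStep hV k).aemeasurable

/-- The conditional probability given the whole past is almost surely a function of `V (k + 1)`,
hence a constant `c` on the event that this state is `w`. -/
lemma IsMarkov.exists_measureReal_inter_eq [IsProbabilityMeasure P] (hV : ∀ k, Measurable (V k))
    (hM : IsMarkov P V) (k : ℕ) (w : Vertex (k + 1)) (S : Set (Vertex k)) :
    ∃ c : ℝ, ∀ A, MeasurableSet[generatedFiltration V (k + 1)] A →
      P.real (A ∩ V (k + 1) ⁻¹' {w} ∩ V k ⁻¹' S) = P.real (A ∩ V (k + 1) ⁻¹' {w}) * c := by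
  set h := P⟦V k ⁻¹' S | MeasurableSpace.comap (V (k + 1)) inferInstance⟧ with hh
  have hconst : ∃ c, ∀ ω ∈ V (k + 1) ⁻¹' {w}, h ω = c := by
    by_cases hne : (V (k + 1) ⁻¹' {w}).Nonempty
    · obtain ⟨ω₀, hω₀⟩ := hne
      refine ⟨h ω₀, fun ω hω => ?_⟩
      have hm : Measurable[MeasurableSpace.comap (V (k + 1)) inferInstance] h :=
        stronglyMeasurable_condExp.measurable
      obtain ⟨s, -, hs⟩ := hm (measurableSet_singleton (h ω₀))
      have h0 : ω₀ ∈ V (k + 1) ⁻¹' s := by rw [hs]; rfl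
      have h1 : ω ∈ V (k + 1) ⁻¹' s := by
        rw [Set.mem_preimage, Set.mem_singleton_iff] at hω hω₀
        rwa [Set.mem_preimage, hω, ← hω₀]
      rw [hs] at h1
      exact h1
    · exact ⟨0, fun ω hω => (hne ⟨ω, hω⟩).elim⟩
  obtain ⟨c, hc⟩ := hconst
  refine ⟨c, fun A hA => ?_⟩
  have hF := generatedFiltration_le hV (k + 1)
  have hw : MeasurableSet[generatedFiltration V (k + 1)] (A ∩ V (k + 1) ⁻¹' {w}) :=
    hA.inter (comap_le_generatedFiltration V le_rfl _ ⟨{w}, measurableSet_singleton w, rfl⟩)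
  have hS : MeasurableSet (V k ⁻¹' S) := hV k S.toFinite.measurableSet
  have hint : Integrable ((V k ⁻¹' S).indicator fun _ => (1 : ℝ)) P :=
    (integrable_const 1).indicator hS
  have e1 := setIntegral_condExp hF hint hw
  rw [setIntegral_indicator hS, setIntegral_congr_ae (g := fun _ => c) (hF _ hw) (by
    filter_upwards [hM k S S.toFinite.measurableSet] with ω hω hmem
    rw [hω]
    exact hc ω hmem.2)] at e1
  simpa using e1.symm

lemma IsMarkov.measure_inter_downStep [IsProbabilityMeasure P] (hV : ∀ k, Measurable (V k))
    (hM : IsMarkov P V) (k : ℕ) (w : Vertex (k + 1)) (b : Bool) {A : Set Ω}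
    (hA : MeasurableSet[generatedFiltration V (k + 1)] A) :
    P (A ∩ V (k + 1) ⁻¹' {w} ∩ downStep V k ⁻¹' {b}) =
      P (A ∩ V (k + 1) ⁻¹' {w}) * stepLaw P V k w {b} := by
  by_cases h0 : P (V (k + 1) ⁻¹' {w}) = 0
  · rw [measure_mono_null (fun ω hω => hω.1.2) h0, measure_mono_null (fun ω hω => hω.2) h0, zero_mul]
  have hw : MeasurableSet (V (k + 1) ⁻¹' {w}) := hV _ (measurableSet_singleton w)
  obtain ⟨c, hc⟩ := hM.exists_measureReal_inter_eq hV k w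
    {y | decide ((y : ℕ) ≠ w) = b}
  have hset : ∀ A : Set Ω, A ∩ V (k + 1) ⁻¹' {w} ∩ V k ⁻¹' {y | decide ((y : ℕ) ≠ w) = b} =
      A ∩ V (k + 1) ⁻¹' {w} ∩ downStep V k ⁻¹' {b} := by
    intro A
    ext ω
    simp only [Set.mem_inter_iff, Set.mem_preimage, Set.mem_singleton_iff, Set.mem_ofPred_eq,
      downStep, and_congr_right_iff, and_imp]
    rintro - rfl
    rfl
  simp only [hset] at hc
  have hlaw : (stepLaw P V k w {b}).toReal = c := by
    have h1 := hc Set.univ MeasurableSet.univ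
    rw [Set.univ_inter] at h1
    rw [stepLaw, if_neg h0, Measure.map_apply (measurable_downStep hV k)
      (measurableSet_singleton b), cond_apply hw, ENNReal.toReal_mul, ENNReal.toReal_inv,
      ← measureReal_def, ← measureReal_def, h1, inv_mul_cancel_left₀]
    exact (measureReal_ne_zero_iff).2 h0
  have := isProbabilityMeasure_stepLaw (P := P) hV k w
  rw [← ENNReal.toReal_eq_toReal_iff' (measure_ne_top _ _)
    (ENNReal.mul_ne_top (measure_ne_top _ _) (measure_ne_top _ _)), ENNReal.toReal_mul, hlaw]
  exact hc A hA

/-- The law of a sequence of independent maps of steps, with independent values. -/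
noncomputable def stepMapLaw (P : Measure Ω) (V : ∀ k, Ω → Vertex k) : Measure (∀ k, StepMap k) :=
  Measure.infinitePi fun k => Measure.pi (stepLaw P V k)

lemma measurable_stepMap (hV : ∀ k, Measurable (V k)) (k : ℕ) : Measurable (stepMap V k) :=
  (Measurable.of_discrete (f := fun p : StepMap k × Vertex (k + 1) × Bool =>
    Function.update p.1 p.2.1 p.2.2)).comp (((measurable_pi_apply k).comp measurable_snd).prodMk
      (((hV (k + 1)).comp measurable_fst).prodMk ((measurable_downStep hV k).comp measurable_fst)))

variable [IsProbabilityMeasure P]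

lemma isProbabilityMeasure_stepMapLaw (hV : ∀ k, Measurable (V k)) :
    IsProbabilityMeasure (stepMapLaw P V) := by
  have := fun k w => isProbabilityMeasure_stepLaw (P := P) hV k w
  unfold stepMapLaw
  infer_instance

/-- The value at `w` is left free because the correction overwrites it; its factor in the product
law is 1. -/
lemma stepMapLaw_inter (hV : ∀ k, Measurable (V k)) (k : ℕ) (w : Vertex (k + 1)) (g : StepMap k)
    {B : Set (∀ k, StepMap k)}
    (hB : MeasurableSet[generatedFiltration (fun j (η : ∀ k, StepMap k) => η j) (k + 1)] B) :
    stepMapLaw P V ({η | ∀ v ≠ w, η k v = g v} ∩ B) =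
      (∏ v ∈ Finset.univ.erase w, stepLaw P V k v {g v}) * stepMapLaw P V B := by
  have := fun k w => isProbabilityMeasure_stepLaw (P := P) hV k w
  have hind : iIndepFun (fun j (η : ∀ k, StepMap k) => η j) (stepMapLaw P V) :=
    iIndepFun_infinitePi (X := fun _ => id) fun _ => measurable_id
  have hind2 := indep_iSup_of_disjoint (fun j => (measurable_pi_apply j).comap_le) hind.iIndep
    (S := {k}) (T := {j | j ≥ k + 1}) (by simp)
  have hR : {η : ∀ k, StepMap k | ∀ v ≠ w, η k v = g v} =
      (fun η => η k) ⁻¹' (Set.univ.pi fun v => if v = w then Set.univ else {g v}) := by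
    ext η
    simp only [Set.mem_ofPred_eq, Set.mem_preimage, Set.mem_pi, Set.mem_univ, forall_const]
    refine forall_congr' fun v => ?_
    by_cases hv : v = w <;> simp [hv]
  have hm : MeasurableSet (Set.univ.pi fun v => if v = w then Set.univ else {g v}) :=
    (Set.toFinite _).measurableSet
  rw [(Indep_iff _ _ _).1 hind2 _ B ?_ hB, hR]
  · congr 1
    rw [← Measure.map_apply (measurable_pi_apply k) hm, stepMapLaw, Measure.infinitePi_map_eval,
      Measure.pi_pi, ← Finset.mul_prod_erase _ _ (Finset.mem_univ w)]
    simp only [if_true, measure_univ, one_mul]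
    exact Finset.prod_congr rfl fun v hv => by rw [if_neg (Finset.ne_of_mem_erase hv)]
  · rw [hR]
    exact (le_iSup₂ (f := fun j (_ : j ∈ ({k} : Set ℕ)) => MeasurableSpace.comap
      (fun η : ∀ k, StepMap k => η j) inferInstance) k rfl) _ ⟨_, hm, rfl⟩

/-- Split according to the visited state `w`. The auxiliary map supplies the factors at all vertices
other than `w`, and the Markov property the one at `w`. The completed product no longer depends on
`w`, so the sum over `w` restores `A`. -/
lemma prod_stepMap_inter (hV : ∀ k, Measurable (V k)) (hM : IsMarkov P V) (k : ℕ) (g : StepMap k)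
    {A : Set Ω} (hA : MeasurableSet[generatedFiltration V (k + 1)] A) {B : Set (∀ k, StepMap k)}
    (hB : MeasurableSet[generatedFiltration (fun j (η : ∀ k, StepMap k) => η j) (k + 1)] B) :
    P.prod (stepMapLaw P V) (stepMap V k ⁻¹' {g} ∩ A ×ˢ B) =
      (∏ v, stepLaw P V k v {g v}) * P.prod (stepMapLaw P V) (A ×ˢ B) := by
  have := isProbabilityMeasure_stepMapLaw (P := P) hV
  have hA' := generatedFiltration_le hV (k + 1) _ hA
  have hB' : MeasurableSet B :=
    generatedFiltration_le (fun j => measurable_pi_apply j) (k + 1) _ hB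
  have hw : ∀ w, MeasurableSet (V (k + 1) ⁻¹' {w}) := fun w => hV _ (measurableSet_singleton w)
  have hset : stepMap V k ⁻¹' {g} ∩ A ×ˢ B = ⋃ w, (A ∩ V (k + 1) ⁻¹' {w} ∩
      downStep V k ⁻¹' {g w}) ×ˢ ({η | ∀ v ≠ w, η k v = g v} ∩ B) := by
    ext ⟨ω, η⟩
    simp only [Set.mem_inter_iff, Set.mem_preimage, Set.mem_singleton_iff, Set.mem_prod,
      Set.mem_iUnion, Set.mem_ofPred_eq, stepMap, Function.update_eq_iff]
    constructor
    · rintro ⟨⟨h1, h2⟩, h3, h4⟩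
      exact ⟨_, ⟨⟨h3, rfl⟩, h1⟩, h2, h4⟩
    · rintro ⟨w, ⟨⟨h3, rfl⟩, h1⟩, h2, h4⟩
      exact ⟨⟨h1, h2⟩, h3, h4⟩
  have hR : ∀ w, MeasurableSet {η : ∀ k, StepMap k | ∀ v ≠ w, η k v = g v} := fun w =>
    measurable_pi_apply k (Set.toFinite {t : StepMap k | ∀ v ≠ w, t v = g v}).measurableSet
  rw [hset, measure_iUnion]
  · simp only [Measure.prod_prod, hM.measure_inter_downStep hV k _ _ hA,
      stepMapLaw_inter (P := P) hV k _ g hB]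
    have hterm : ∀ w, P (A ∩ V (k + 1) ⁻¹' {w}) * stepLaw P V k w {g w} *
        ((∏ v ∈ Finset.univ.erase w, stepLaw P V k v {g v}) * stepMapLaw P V B) =
        P (A ∩ V (k + 1) ⁻¹' {w}) * ((∏ v, stepLaw P V k v {g v}) * stepMapLaw P V B) := by
      intro w
      rw [← Finset.mul_prod_erase _ _ (Finset.mem_univ w)]
      ring
    have hsum : ∑' w, P (A ∩ V (k + 1) ⁻¹' {w}) = P A := by
      rw [← measure_iUnion _ fun w => hA'.inter (hw w)]
      · congr 1
        ext; simp
      · intro w w' hne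
        refine Set.disjoint_left.2 ?_
        rintro ω ⟨-, h1⟩ ⟨-, h2⟩
        exact hne (h1.symm.trans h2)
    rw [tsum_congr hterm, ENNReal.tsum_mul_right, hsum]
    ring
  · intro w w' hne
    refine Set.Disjoint.set_prod_left (Set.disjoint_left.2 ?_) _ _
    rintro ω ⟨⟨-, h1⟩, -⟩ ⟨⟨-, h2⟩, -⟩
    exact hne (h1.symm.trans h2)
  · exact fun w => ((hA'.inter (hw w)).inter (measurable_downStep hV k
      (measurableSet_singleton _))).prod ((hR w).inter hB')

lemma indep_stepMap (hV : ∀ k, Measurable (V k)) (hM : IsMarkov P V) (k : ℕ) :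
    Indep (MeasurableSpace.comap (stepMap V k) inferInstance)
      (MeasurableSpace.comap Prod.fst (generatedFiltration V (k + 1)) ⊔
        MeasurableSpace.comap Prod.snd
          (generatedFiltration (fun j (η : ∀ k, StepMap k) => η j) (k + 1)))
      (P.prod (stepMapLaw P V)) := by
  have := isProbabilityMeasure_stepMapLaw (P := P) hV
  have hF := generatedFiltration_le hV (k + 1)
  have hH := generatedFiltration_le
    (fun j => measurable_pi_apply (X := StepMap) j) (k + 1)
  refine indep_sup_right_of_inter (measurable_stepMap hV k).comap_le
    ((MeasurableSpace.comap_mono hF).trans measurable_fst.comap_le)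
    ((MeasurableSpace.comap_mono hH).trans measurable_snd.comap_le) ?_
  rintro _ _ _ ⟨s, hs, rfl⟩ ⟨A, hA, rfl⟩ ⟨B, hB, rfl⟩
  have hAB : MeasurableSet (A ×ˢ B) := (hF _ hA).prod (hH _ hB)
  -- Independence is checked on the points of the finite space of maps; the case of full `A` and `B`
  -- identifies the law of the corrected map.
  have hmap : ((P.prod (stepMapLaw P V)).restrict (A ×ˢ B)).map (stepMap V k) =
      P.prod (stepMapLaw P V) (A ×ˢ B) • (P.prod (stepMapLaw P V)).map (stepMap V k) := by
    refine Measure.ext_of_singleton fun g => ?_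
    have hg := measurable_stepMap hV k (measurableSet_singleton g)
    have h1 := prod_stepMap_inter hV hM k g (MeasurableSet.univ) (MeasurableSet.univ)
    rw [Set.univ_prod_univ, Set.inter_univ, measure_univ, mul_one] at h1
    rw [Measure.smul_apply, Measure.map_apply (measurable_stepMap hV k) (measurableSet_singleton g),
      Measure.map_apply (measurable_stepMap hV k) (measurableSet_singleton g),
      Measure.restrict_apply hg, prod_stepMap_inter hV hM k g hA hB, h1, smul_eq_mul, mul_comm]
  have h2 := congrArg (fun ν => ν s) hmap
  simp only [Measure.smul_apply, smul_eq_mul] at h2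
  rw [Measure.map_apply (measurable_stepMap hV k) hs,
    Measure.map_apply (measurable_stepMap hV k) hs,
    Measure.restrict_apply (measurable_stepMap hV k hs)] at h2
  rw [← Set.prod_eq, h2, mul_comm]

end Representation

/-! ### Assembling the parameterization and the immersion -/

section Conclusion

lemma generatedFiltration_comp {Ω Ω' : Type*} {E : ℕ → Type*} [∀ k, MeasurableSpace (E k)]
    (X : ∀ k, Ω → E k) (f : Ω' → Ω) (k : ℕ) :
    generatedFiltration (fun k ω => X k (f ω)) k =
      MeasurableSpace.comap f (generatedFiltration X k) := by
  simp only [generatedFiltration, MeasurableSpace.comap_iSup, MeasurableSpace.comap_comp]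
  rfl

lemma IsKolmogorovian.comap_fst {Ω Ω' : Type*} [MeasurableSpace Ω] [MeasurableSpace Ω']
    [Nonempty Ω'] {P : Measure Ω} {Q : Measure Ω'} [IsProbabilityMeasure Q] [SFinite P]
    {F : ℕ → MeasurableSpace Ω} (hK : IsKolmogorovian P F) :
    IsKolmogorovian (P.prod Q) fun k => MeasurableSpace.comap Prod.fst (F k) := by
  intro s hs
  rw [MeasurableSpace.measurableSet_iInf] at hs
  choose A hA hAs using hs
  -- The projection is surjective, so a tail event of the product is the preimage of one set, which
  -- belongs to every `F k`.
  have hA0 : ∀ k, A k = A 0 := fun k =>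
    Set.preimage_injective.2 (Prod.fst_surjective (β := Ω')) ((hAs k).trans (hAs 0).symm)
  have h0 : MeasurableSet[⨅ k, F k] (A 0) := by
    rw [MeasurableSpace.measurableSet_iInf]
    exact fun k => hA0 k ▸ hA k
  have := hK _ h0
  rwa [← hAs 0, ← Set.prod_univ, Measure.prod_prod, measure_univ, mul_one]

/-- Codes the maps by real numbers without changing the σ-fields they generate. -/
lemma exists_injective_real (k : ℕ) :
    ∃ e : StepMap k → ℝ, MeasurableEmbedding e := by
  obtain ⟨e, he⟩ := Countable.exists_injective_nat (StepMap k)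
  exact ⟨fun t => e t, ⟨Nat.cast_injective.comp he, Measurable.of_discrete,
    fun _ _ => ((Set.toFinite _).image _).measurableSet⟩⟩

lemma SubsetAE.of_le {Ω : Type*} {m₁ m₂ : MeasurableSpace Ω} [MeasurableSpace Ω] {P : Measure Ω}
    (h : m₁ ≤ m₂) : SubsetAE P m₁ m₂ :=
  h.trans (le_eventuallyMeasurableSpace (l := ae P))

/-- A Kolmogorovian Markov process on the vertices of the Pascal graph which moves along the edges
is, up to isomorphism, generated by a parameterization whose filtration is of product type. -/
theorem exists_isGeneratingParameterization {Ω : Type} [MeasurableSpace Ω] [StandardBorelSpace Ω]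
    {P : Measure Ω} [IsProbabilityMeasure P] {V : ∀ k, Ω → Vertex k} (hV : ∀ k, Measurable (V k))
    (hstep : ∀ k ω, (V (k + 1) ω : ℕ) = V k ω ∨ (V (k + 1) ω : ℕ) = V k ω + 1)
    (hK : IsKolmogorovian P (generatedFiltration V)) (hM : IsMarkov P V) :
    ∃ (Ω' : Type) (_ : MeasurableSpace Ω') (P' : Measure Ω') (_ : IsProbabilityMeasure P')
      (V' : ∀ k, Ω' → Vertex k) (U : ℕ → Ω' → ℝ),
      IsCopy P' V' P V ∧ IsGeneratingParameterization P' (generatedFiltration V') U ∧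
      iIndepFun U P' ∧ IsImmersed P' (generatedFiltration V') (generatedFiltration U) := by
  have := isProbabilityMeasure_stepMapLaw (P := P) hV
  choose e he using exists_injective_real
  set P' := P.prod (stepMapLaw P V) with hP'
  set V' : ∀ k, (Ω × ∀ k, StepMap k) → Vertex k := fun k ω => V k ω.1 with hV'def
  set W := stepMap V with hW'
  set U : ℕ → (Ω × ∀ k, StepMap k) → ℝ := fun k ω => e k (W k ω) with hU
  have hV' : ∀ k, Measurable (V' k) := fun k => (hV k).comp measurable_fst
  have hW : ∀ k, Measurable (W k) := measurable_stepMap hV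
  have hUm : ∀ k, Measurable (U k) := fun k => (he k).measurable.comp (hW k)
  have hcomap : ∀ k, MeasurableSpace.comap (U k) inferInstance =
      MeasurableSpace.comap (W k) inferInstance := fun k => by
    rw [← (he k).comap_eq, MeasurableSpace.comap_comp]
    rfl
  have hgen : generatedFiltration U = generatedFiltration W := by
    funext k
    simp only [generatedFiltration, hcomap]
  have hFV' : ∀ k, generatedFiltration V' k =
      MeasurableSpace.comap Prod.fst (generatedFiltration V k) :=
    generatedFiltration_comp V Prod.fst
  -- `W j` is computed from `V' j`, `V' (j + 1)` and the auxiliary map at depth `j`, none of which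
  -- is later than depth `k`.
  have hGW : ∀ k, generatedFiltration W k ≤
      MeasurableSpace.comap Prod.fst (generatedFiltration V k) ⊔ MeasurableSpace.comap Prod.snd
        (generatedFiltration (fun j (η : ∀ k, StepMap k) => η j) k) := by
    intro k
    rw [← hFV', ← generatedFiltration_comp]
    refine iSup₂_le fun j hj => ?_
    set m := generatedFiltration V' k ⊔
      generatedFiltration (fun j (ω : Ω × ∀ k, StepMap k) => ω.2 j) k with hm
    have hVm : ∀ i, k ≤ i → Measurable[m] (V' i) := fun i hi =>
      (comap_measurable (V' i)).mono ((comap_le_generatedFiltration V' hi).trans le_sup_left) le_rfl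
    have hηm : Measurable[m] fun ω : Ω × ∀ k, StepMap k => ω.2 j :=
      (comap_measurable _).mono ((comap_le_generatedFiltration
        (fun j (ω : Ω × ∀ k, StepMap k) => ω.2 j) hj).trans le_sup_right) le_rfl
    have hWm : Measurable[m] (W j) :=
      (Measurable.of_discrete (f := fun p : StepMap j × Vertex (j + 1) × Vertex j =>
        Function.update p.1 p.2.1 (decide ((p.2.2 : ℕ) ≠ p.2.1)))).comp
        (hηm.prodMk ((hVm (j + 1) (by omega)).prodMk (hVm j hj)))
    exact hWm.comap_le
  have hind : ∀ k, Indep (MeasurableSpace.comap (W k) inferInstance)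
      (generatedFiltration V' (k + 1) ⊔ generatedFiltration W (k + 1)) P' := fun k => by
    refine indep_of_indep_of_le_right (indep_stepMap hV hM k) (sup_le ?_ (hGW (k + 1)))
    rw [hFV']
    exact le_sup_left
  have hrec : ∀ k ω, (V' k ω : ℕ) = nextState k (W k ω) (V' (k + 1) ω) :=
    eq_nextState_stepMap hstep
  have hsub : ∀ k, generatedFiltration V' k ≤
      generatedFiltration V' (k + 1) ⊔ MeasurableSpace.comap (W k) inferInstance := by
    intro k
    refine iSup₂_le fun j hj => ?_
    rcases eq_or_lt_of_le hj with rfl | hlt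
    · set m := generatedFiltration V' (k + 1) ⊔ MeasurableSpace.comap (W k) inferInstance
      have h1 : Measurable[m] (V' (k + 1)) := (comap_measurable _).mono
        ((comap_le_generatedFiltration V' le_rfl).trans le_sup_left) le_rfl
      have h2 : Measurable[m] (W k) := (comap_measurable _).mono le_sup_right le_rfl
      have h3 : V' k = fun ω => Fin.ofNat (k + 1) (nextState k (W k ω) (V' (k + 1) ω)) := by
        funext ω
        rw [← hrec, Fin.ofNat_val_eq_self]
      have h4 : Measurable[m] (V' k) := by
        rw [h3]
        exact (Measurable.of_discrete (f := fun p : StepMap k × Vertex (k + 1) =>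
          Fin.ofNat (k + 1) (nextState k p.1 p.2))).comp (h2.prodMk h1)
      exact h4.comap_le
    · exact (comap_le_generatedFiltration V' hlt).trans le_sup_left
  have hK' : IsKolmogorovian P' (generatedFiltration V') := by
    rw [show generatedFiltration V' = _ from funext hFV']
    exact hK.comap_fst
  have hsubW := subsetAE_generatedFiltration_of_monotone hV' hW nextState_le nextState_mono hrec
    hind hK'
  refine ⟨Ω × ∀ k, StepMap k, inferInstance, P', inferInstance, V', U, ⟨hV', ?_⟩,
    ⟨⟨hUm, fun k => ?_, fun k => ?_⟩, fun k => ?_⟩, ?_, fun k => ?_, fun k => ?_⟩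
  · have h1 : Measurable fun ω k => V k ω := measurable_pi_lambda _ hV
    conv_rhs => rw [← Measure.fst_prod (μ := P) (ν := stepMapLaw P V)]
    rw [Measure.fst, Measure.map_map h1 measurable_fst]
    rfl
  · rw [hcomap, hgen]
    exact hind k
  · rw [hcomap]
    exact SubsetAE.of_le (hsub k)
  · rw [hgen]
    exact hsubW k
  · refine iIndepFun_of_indep_generatedFiltration fun k => ?_
    rw [hcomap, hgen]
    exact indep_of_indep_of_le_right (hind k) le_sup_right
  · rw [hgen]
    exact hsubW k
  · rw [hgen]
    exact condIndepGiven_of_indep (generatedFiltration_le hV' _) (generatedFiltration_le hW _)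
      (hW k).comap_le (hsub k) (hind k)

end Conclusion

/-! ### Paths of the Pascal graph -/

section PascalGraph

instance : StandardBorelSpace Path := by
  have h : MeasurableSet {γ : ∀ k, Edge k | ∀ k, (γ k).1.2 = (γ (k + 1)).1.1} := by
    rw [Set.ofPred_forall]
    refine MeasurableSet.iInter fun k => measurableSet_eq_fun ?_ ?_
    · exact (Measurable.of_discrete (f := fun e : Edge k => e.1.2)).comp (measurable_pi_apply k)
    · exact (Measurable.of_discrete (f := fun e : Edge (k + 1) => e.1.1)).comp
        (measurable_pi_apply (k + 1))
  exact h.standardBorel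

lemma measurable_pathEdge (k : ℕ) : Measurable (pathEdge k) :=
  (measurable_pi_apply k).comp measurable_subtype_coe

lemma measurable_pathVertex (k : ℕ) : Measurable (pathVertex k) :=
  (Measurable.of_discrete (f := fun e : Edge k => e.1.1)).comp (measurable_pathEdge k)

lemma pathVertex_succ_eq_or (k : ℕ) (γ : Path) :
    (pathVertex (k + 1) γ : ℕ) = pathVertex k γ ∨
      (pathVertex (k + 1) γ : ℕ) = pathVertex k γ + 1 := by
  have h : pathVertex (k + 1) γ = (pathEdge k γ).1.2 := (γ.2 k).symm
  rw [h]
  exact (pathEdge k γ).2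

/-- Vertices are functions of the edges, so their tail σ-field is the smaller one. -/
lemma IsErgodic.isKolmogorovian_pathVertex {μ : Measure Path} (h : IsErgodic μ) :
    IsKolmogorovian μ (generatedFiltration pathVertex) := by
  intro s hs
  have hle : ∀ k, generatedFiltration pathVertex k ≤ generatedFiltration pathEdge k := by
    refine fun k => iSup₂_mono fun j _ => ?_
    exact ((Measurable.of_discrete (f := fun e : Edge j => e.1.1)).comp
      (comap_measurable (pathEdge j))).comap_le
  exact h s (iInf_mono hle s hs)

end PascalGraph

end PascalWalk

theorem theorem6p2 (μ : Measure PascalWalk.Path) [IsProbabilityMeasure μ]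
    (hErgodic : PascalWalk.IsErgodic μ)
    (hMarkov : PascalWalk.IsMarkov μ PascalWalk.pathVertex) :
    PascalWalk.AdmitsGeneratingParameterization μ PascalWalk.pathVertex ∧
      PascalWalk.IsStandard μ PascalWalk.pathVertex := by
  obtain ⟨Ω', mΩ', P', hP', V', U, hcopy, hgen, hindep, himm⟩ :=
    PascalWalk.exists_isGeneratingParameterization PascalWalk.measurable_pathVertex
      PascalWalk.pathVertex_succ_eq_or hErgodic.isKolmogorovian_pathVertex hMarkov
  exact ⟨⟨Ω', mΩ', P', hP', V', U, hcopy, hgen⟩, Ω', mΩ', P', hP', V',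
    PascalWalk.generatedFiltration U, hcopy, ⟨U, hgen.1.measurable, hindep, rfl⟩, himm⟩
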